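/- Notation. For $A,B\in\mathbb R^{n\times m}$ let $\langle A,B\rangle=\sum_{i,j}A_{ij}B_{ij}$, $\|A\|_F^2=\langle A,A\rangle$ and $\mathbf D_2(A,B)=\|A-B\|_F^2/2$. For a differentiable $\psi:\mathbb R^{n\times m}\to\mathbb R$ let $\boldsymbol\Delta_\psi(\alpha,\beta)=\psi(\alpha)-\psi(\beta)-\langle\nabla\psi(\beta),\alpha-\beta\rangle$. For $B\in\mathbb R^{p\times m}$ let $\|B\|_{2,\mathcal C}$ be the number of distinct rows of $B$ and, for a given $X\in\mathbb R^{n\times p}$, let $$P_o(B)=\{\|B\|_{2,\mathcal C}\wedge \mathrm{rank}(X)+m\}\,\mathrm{rank}(B)+\{p-\|B\|_{2,\mathcal C}\}\log\|B\|_{2,\mathcal C}.$$ For a real random variable $Z$ let $\|Z\|_{\psi_2}=\inf\{t>0:\mathbb E\exp[(Z/t)^2]\le 2\}$. Theorem. For all constants $\delta>0$ and $C\ge 0$ there is $A_0$, depending only on $\delta$ and $C$, such that for every $A\ge A_0$ there is a constant $c>0$, depending only on $\delta,C,A$, with the following property. Let $n,p,m$ be natural numbers, $X\in\mathbb R^{n\times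 p}$ a fixed design matrix, $Y$ a random $n\times m$ response, $l_0(\eta;Y)$ a loss that is differentiable in $\eta\in\mathbb R^{n\times m}$, $B^*\in\mathbb R^{p\times m}$ with $B^*\ne 0$, and $\sigma\ge0$. Put $r^*=\mathrm{rank}(B^*)$ and $q^*=\|B^*\|_{2,\mathcal C}$. Assume that the effective noise $E=-\nabla l_0(XB^*;Y)$ (gradient in the first argument) is a sub-Gaussian random matrix with mean zero and scale bounded by $\sigma$, that is, $\mathbb E E=0$ and $\|\langle E,\alpha\rangle\|_{\psi_2}\le\sigma\|\alpha\|_F$ for all $\alpha\in\mathbb R^{n\times m}$, and that, almost surely, for all $B_1,B_2\in\mathbb R^{p\times m}$, $$\boldsymbol\Delta_{l_0(\cdot;Y)}(XB_1,XB_2)+C\sigma^2P_o(B_1)+C\sigma^2P_o(B_2)\ \ge\ \delta\,\mathbf D_2(XB_1,XB_2).$$ Then any $\hat B$ that (almost surely) minimizes over $B\in\mathbb R^{p\times m}$ the predictive information criterion $$l_0(XB;Y)+A\sigma^2\big[\{\|B\|_{2,\mathcal C}\wedge\mathrm{rank}(X)+m\}\,\mathrm{rank}(B)+\{p-\|B\|_{2,\mathcal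 C}\}\log\|B\|_{2,\mathcal C}\big]$$ satisfies $$\mathbb E\big[\|X\hat B-XB^*\|_F^2\vee \sigma^2P_o(\hat B)\big]\ \le\ c\,\sigma^2\big\{(q^*\wedge\mathrm{rank}(X)+m)r^*+(p-q^*)\log q^*\big\}.$$ -/

import Mathlib

open MeasureTheory

/-- The Frobenius inner product `⟨A, B⟩ = ∑ i j, A i j * B i j`. -/
noncomputable def frobInner {n m : ℕ} (A B : Matrix (Fin n) (Fin m) ℝ) : ℝ :=
  ∑ i, ∑ j, A i j * B i j

/-- The squared Frobenius norm. -/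
noncomputable def frobSq {n m : ℕ} (A : Matrix (Fin n) (Fin m) ℝ) : ℝ :=
  ∑ i, ∑ j, A i j ^ 2

/-- `D₂(A, B) = ‖A - B‖_F² / 2`. -/
noncomputable def D2 {n m : ℕ} (A B : Matrix (Fin n) (Fin m) ℝ) : ℝ :=
  frobSq (A - B) / 2

/-- The gradient of a function of a matrix: the matrix of its partial derivatives, i.e. for a
(Fréchet) differentiable function its gradient for the Frobenius inner product. -/
noncomputable def matGradient {n m : ℕ} (f : Matrix (Fin n) (Fin m) ℝ → ℝ)
    (η : Matrix (Fin n) (Fin m) ℝ) : Matrix (Fin n) (Fin m) ℝ :=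
  Matrix.of fun i j => fderiv ℝ f η (Matrix.single i j 1)

/-- The generalized Bregman function `Δ_ψ(α, β) = ψ(α) - ψ(β) - ⟨∇ψ(β), α - β⟩`. -/
noncomputable def genBregman {n m : ℕ} (ψ : Matrix (Fin n) (Fin m) ℝ → ℝ)
    (α β : Matrix (Fin n) (Fin m) ℝ) : ℝ :=
  ψ α - ψ β - frobInner (matGradient ψ β) (α - β)

/-- `‖B‖_{2,𝒞}`: the number of distinct rows of `B`. -/
noncomputable def numDistinctRows {p m : ℕ} (B : Matrix (Fin p) (Fin m) ℝ) : ℕ :=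
  (Set.range fun i => B i).ncard

/-- The model complexity
`P_o(B) = (‖B‖_{2,𝒞} ∧ rank X + m) rank B + (p - ‖B‖_{2,𝒞}) log ‖B‖_{2,𝒞}`. -/
noncomputable def complexityPo {n p m : ℕ} (X : Matrix (Fin n) (Fin p) ℝ)
    (B : Matrix (Fin p) (Fin m) ℝ) : ℝ :=
  (min (numDistinctRows B : ℝ) (X.rank : ℝ) + (m : ℝ)) * (B.rank : ℝ)
    + ((p : ℝ) - (numDistinctRows B : ℝ)) * Real.log (numDistinctRows B : ℝ)

/-- The predictive information criterion `l₀(XB; y) + A σ² P_o(B)`. The first argument of `l₀` is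
the systematic component, the second one the response. -/
noncomputable def pic {n p m : ℕ}
    (l₀ : Matrix (Fin n) (Fin m) ℝ → Matrix (Fin n) (Fin m) ℝ → ℝ)
    (X : Matrix (Fin n) (Fin p) ℝ) (y : Matrix (Fin n) (Fin m) ℝ) (A σ : ℝ)
    (B : Matrix (Fin p) (Fin m) ℝ) : ℝ :=
  l₀ (X * B) y + A * σ ^ 2 * complexityPo X B

/-- The effective noise `E = -∇ l₀(X B*; Y)`, the gradient being taken in the systematic
component. -/
noncomputable def effectiveNoise {n p m : ℕ} {Ω : Type*}
    (l₀ : Matrix (Fin n) (Fin m) ℝ → Matrix (Fin n) (Fin m) ℝ → ℝ)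
    (X : Matrix (Fin n) (Fin p) ℝ) (Y : Ω → Matrix (Fin n) (Fin m) ℝ)
    (Bstar : Matrix (Fin p) (Fin m) ℝ) (ω : Ω) : Matrix (Fin n) (Fin m) ℝ :=
  -matGradient (fun η => l₀ η (Y ω)) (X * Bstar)

/-- The Orlicz norm `‖Z‖_{ψ₂} = inf {t > 0 : 𝔼 exp((Z / t)²) ≤ 2}`, with values in `[0, ∞]`
(it is `∞` if there is no such `t`). -/
noncomputable def psi2Norm {Ω : Type*} [MeasurableSpace Ω] (μ : Measure Ω) (Z : Ω → ℝ) : ENNReal :=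
  sInf {s : ENNReal | ∃ t : ℝ, 0 < t ∧
    ∫⁻ ω, ENNReal.ofReal (Real.exp ((Z ω / t) ^ 2)) ∂μ ≤ 2 ∧ s = ENNReal.ofReal t}

/-- The random matrix `E` (that is, its vectorization) is sub-Gaussian with mean zero and scale
bounded by `σ`. -/
structure IsCenteredSubGaussian {n m : ℕ} {Ω : Type*} [MeasurableSpace Ω] (μ : Measure Ω)
    (E : Ω → Matrix (Fin n) (Fin m) ℝ) (σ : ℝ) : Prop where
  aemeasurable : ∀ i j, AEMeasurable (fun ω => E ω i j) μ
  mean_zero : ∀ i j, ∫ ω, E ω i j ∂μ = 0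
  psi2_le : ∀ α : Matrix (Fin n) (Fin m) ℝ,
    psi2Norm μ (fun ω => frobInner (E ω) α) ≤ ENNReal.ofReal (σ * Real.sqrt (frobSq α))

/-! Comparing the criterion at `Bhat` and at `Bstar` and inserting the curvature condition leaves
δ/2 ‖XB̂ - XB*‖² + (A - C)σ²P_o(B̂) ≤ ⟨E, XB̂ - XB*⟩ + (A + C)σ²P_o(B*) (`oracle_basic_inequality`).
It remains to bound the noise term uniformly in B̂ (`exists_uniform_bound`).

Fix the partition of the rows of B into q classes and the rank r of B. Then XB - XB* = QzV + Q'z'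
with Q, Q' fixed matrices with orthonormal columns and V with orthonormal rows (`exists_split`).
Here Q has at most q ∧ rank X + r* columns, so nets for such matrices have log-cardinality of order
(q ∧ rank X + r* + m)r, and the codes of the partitions contribute order (p - q) log q. Since r r* ≤
m r*, this is P_o(B) + P_o(B*) up to constants: the penalty is the metric entropy of the model.

No tail bound is used. The variables exp((⟨E, W⟩/3σ)²) are summed over all nets with weights
exp(-L), L being the entropy; the sum R has bounded mean, and R alone yields ⟨E, W⟩ ≤ 3σ√(L + R) at
all net points simultaneously. Young's inequality absorbs the loss and P_o(B̂) into the left side,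
and integrating R finishes the proof; P_o(B*) ≥ 1 swallows additive constants. -/

/-! ### Nets of unit balls and suprema of bilinear forms. -/

section Nets

variable {F : Type*} [NormedAddCommGroup F] [NormedSpace ℝ F] [FiniteDimensional ℝ F]

/-- The unit ball of a `d`-dimensional normed space has a `1/2`-net with at most `5 ^ d` points. -/
theorem exists_half_net (F : Type*) [NormedAddCommGroup F] [NormedSpace ℝ F]
    [FiniteDimensional ℝ F] :
    ∃ s : Finset F, (∀ c ∈ s, ‖c‖ ≤ 1) ∧ s.card ≤ 5 ^ Module.finrank ℝ F ∧
      ∀ x : F, ‖x‖ ≤ 1 → ∃ c ∈ s, ‖x - c‖ ≤ 1 / 2 := by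
  classical
  -- Radius 2 and separation 1 are the normalisation of the Besicovitch packing bound. A packing of
  -- maximal cardinality is a 1-net of the ball of radius 2; halving it gives the claim.
  let good : Finset F → Prop := fun s =>
    (∀ c ∈ s, ‖c‖ ≤ 2) ∧ ∀ c ∈ s, ∀ d ∈ s, c ≠ d → 1 ≤ ‖c - d‖
  let P : ℕ → Prop := fun k => ∃ s : Finset F, good s ∧ s.card = k
  set D := 5 ^ Module.finrank ℝ F with hD
  have hcard : ∀ s, good s → s.card ≤ D := fun s hs =>
    Besicovitch.card_le_of_separated s hs.1 hs.2
  have h0 : P 0 := ⟨∅, ⟨by simp, by simp⟩, by simp⟩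
  obtain ⟨s, hs, hsk⟩ : P (Nat.findGreatest P D) := Nat.findGreatest_spec (Nat.zero_le D) h0
  have hnet : ∀ x : F, ‖x‖ ≤ 2 → ∃ c ∈ s, ‖x - c‖ ≤ 1 := by
    intro x hx
    by_contra! hfar
    have hxs : x ∉ s := fun h => by
      have := hfar x h
      simp at this
      linarith
    have hgood : good (insert x s) := by
      refine ⟨?_, ?_⟩
      · intro c hc
        rcases Finset.mem_insert.1 hc with rfl | hc
        · exact hx
        · exact hs.1 c hc
      · intro c hc d hd hcd
        rcases Finset.mem_insert.1 hc with rfl | hc'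
        · rcases Finset.mem_insert.1 hd with rfl | hd'
          · exact absurd rfl hcd
          · exact (hfar d hd').le
        · rcases Finset.mem_insert.1 hd with rfl | hd'
          · rw [norm_sub_rev]
            exact (hfar c hc').le
          · exact hs.2 c hc' d hd' hcd
    have hc := Finset.card_insert_of_notMem hxs
    exact Nat.findGreatest_is_greatest (P := P) (n := D) (k := (insert x s).card) (by omega)
      (hcard _ hgood) ⟨_, hgood, rfl⟩
  refine ⟨s.image fun c => (1 / 2 : ℝ) • c, ?_, Finset.card_image_le.trans (hcard s hs), ?_⟩
  · intro c hc
    obtain ⟨d, hd, rfl⟩ := Finset.mem_image.1 hc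
    have := hs.1 d hd
    rw [norm_smul]
    norm_num
    linarith
  · intro x hx
    obtain ⟨c, hc, hxc⟩ := hnet ((2 : ℝ) • x) (by rw [norm_smul]; norm_num; linarith)
    refine ⟨_, Finset.mem_image_of_mem _ hc, ?_⟩
    have : x - (1 / 2 : ℝ) • c = (1 / 2 : ℝ) • ((2 : ℝ) • x - c) := by
      rw [smul_sub, smul_smul]; norm_num
    rw [this, norm_smul]
    norm_num
    linarith

/-- A `1/4`-net of the unit ball, contained in the ball of radius `3/2`. -/
theorem exists_quarter_net (F : Type*) [NormedAddCommGroup F] [NormedSpace ℝ F]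
    [FiniteDimensional ℝ F] :
    ∃ s : Finset F, (∀ c ∈ s, ‖c‖ ≤ 3 / 2) ∧ s.card ≤ 25 ^ Module.finrank ℝ F ∧
      ∀ x : F, ‖x‖ ≤ 1 → ∃ c ∈ s, ‖x - c‖ ≤ 1 / 4 := by
  classical
  obtain ⟨s, hs, hcard, hnet⟩ := exists_half_net F
  -- The half-net is applied twice: to x, then to the doubled residual 2(x - a), which is again in
  -- the unit ball.
  refine ⟨Finset.image₂ (fun a b => a + (1 / 2 : ℝ) • b) s s, ?_, ?_, ?_⟩
  · intro c hc
    obtain ⟨a, ha, b, hb, rfl⟩ := Finset.mem_image₂.1 hc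
    refine (norm_add_le _ _).trans ?_
    rw [norm_smul]
    have h1 := hs a ha
    have h2 := hs b hb
    norm_num
    linarith
  · refine (Finset.card_image₂_le _ _ _).trans ((Nat.mul_le_mul hcard hcard).trans ?_)
    rw [← Nat.mul_pow]
  · intro x hx
    obtain ⟨a, ha, hxa⟩ := hnet x hx
    obtain ⟨b, hb, hxb⟩ := hnet ((2 : ℝ) • (x - a)) (by rw [norm_smul]; norm_num; linarith)
    refine ⟨_, Finset.mem_image₂_of_mem ha hb, ?_⟩
    have : x - (a + (1 / 2 : ℝ) • b) = (1 / 2 : ℝ) • ((2 : ℝ) • (x - a) - b) := by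
      rw [smul_sub, smul_smul]; norm_num; abel
    rw [this, norm_smul]
    norm_num
    linarith

variable {G : Type*} [NormedAddCommGroup G] [NormedSpace ℝ G] [FiniteDimensional ℝ G]

/-- A bilinear form on finite-dimensional spaces has a smallest bound `M`, attained on the product
of the unit balls. -/
theorem exists_bilin_max (β : F →ₗ[ℝ] G →ₗ[ℝ] ℝ) :
    ∃ z₀ : F, ∃ v₀ : G, ‖z₀‖ ≤ 1 ∧ ‖v₀‖ ≤ 1 ∧ 0 ≤ β z₀ v₀ ∧
      ∀ z v, β z v ≤ β z₀ v₀ * (‖z‖ * ‖v‖) := by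
  have : ProperSpace F := FiniteDimensional.proper ℝ F
  have : ProperSpace G := FiniteDimensional.proper ℝ G
  let B : F →L[ℝ] G →L[ℝ] ℝ := LinearMap.toContinuousLinearMap
    ((LinearMap.toContinuousLinearMap : (G →ₗ[ℝ] ℝ) ≃ₗ[ℝ] (G →L[ℝ] ℝ)).toLinearMap ∘ₗ β)
  have hB : ∀ z v, B z v = β z v := fun z v => rfl
  have hcont : Continuous fun x : F × G => β x.1 x.2 := by
    have : Continuous fun x : F × G => B x.1 x.2 := by fun_prop
    exact this
  obtain ⟨⟨z₀, v₀⟩, hmem, hmax⟩ :=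
    ((isCompact_closedBall (0 : F) 1).prod (isCompact_closedBall (0 : G) 1)).exists_isMaxOn
      ⟨(0, 0), by simp⟩ hcont.continuousOn
  simp only [Set.mem_prod, mem_closedBall_zero_iff] at hmem
  have hle : ∀ z v, ‖z‖ ≤ 1 → ‖v‖ ≤ 1 → β z v ≤ β z₀ v₀ := fun z v hz hv =>
    hmax (show (z, v) ∈ _ by simp [hz, hv])
  refine ⟨z₀, v₀, hmem.1, hmem.2, by simpa using hle 0 0 (by simp) (by simp), fun z v => ?_⟩
  rcases eq_or_ne z 0 with rfl | hz
  · simp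
  rcases eq_or_ne v 0 with rfl | hv
  · simp
  have hz' := norm_pos_iff.2 hz
  have hv' := norm_pos_iff.2 hv
  have h := hle (‖z‖⁻¹ • z) (‖v‖⁻¹ • v) (by rw [norm_smul]; simp [hz'.ne'])
    (by rw [norm_smul]; simp [hv'.ne'])
  simp only [map_smul, LinearMap.smul_apply, smul_eq_mul] at h
  calc β z v = (‖v‖⁻¹ * (‖z‖⁻¹ * β z v)) * (‖z‖ * ‖v‖) := by field_simp
    _ ≤ _ := by
      apply mul_le_mul_of_nonneg_right _ (by positivity)
      exact h

/-- Discretization of the supremum of a bilinear form over the product of two unit balls. -/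
theorem exists_bilin_net (F G : Type*) [NormedAddCommGroup F] [NormedSpace ℝ F]
    [FiniteDimensional ℝ F] [NormedAddCommGroup G] [NormedSpace ℝ G] [FiniteDimensional ℝ G] :
    ∃ N : Finset (F × G), N.card ≤ 25 ^ (Module.finrank ℝ F + Module.finrank ℝ G) ∧
      (∀ x ∈ N, ‖x.1‖ ≤ 3 / 2 ∧ ‖x.2‖ ≤ 3 / 2) ∧
      ∀ (β : F →ₗ[ℝ] G →ₗ[ℝ] ℝ) (c : ℝ), (∀ x ∈ N, β x.1 x.2 ≤ c) →
        ∀ z v, β z v ≤ 3 * c * (‖z‖ * ‖v‖) := by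
  obtain ⟨s, hs, hscard, hsnet⟩ := exists_quarter_net F
  obtain ⟨t, ht, htcard, htnet⟩ := exists_quarter_net G
  refine ⟨s ×ˢ t, ?_, ?_, ?_⟩
  · rw [Finset.card_product, pow_add]
    exact Nat.mul_le_mul hscard htcard
  · intro x hx
    rw [Finset.mem_product] at hx
    exact ⟨hs _ hx.1, ht _ hx.2⟩
  · intro β c hc z v
    obtain ⟨z₀, v₀, hz₀, hv₀, hM, hmax⟩ := exists_bilin_max β
    obtain ⟨z', hz', hzz⟩ := hsnet z₀ hz₀
    obtain ⟨v', hv', hvv⟩ := htnet v₀ hv₀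
    have h1 := hc (z', v') (Finset.mk_mem_product hz' hv')
    have h2 := hmax (z₀ - z') v₀
    have h3 := hmax z' (v₀ - v')
    -- The three terms give M ≤ c + M/4 + 3M/8, hence M ≤ 8c/3.
    have e : β z₀ v₀ = β z' v' + β (z₀ - z') v₀ + β z' (v₀ - v') := by
      simp only [map_sub, LinearMap.sub_apply]; ring
    set M := β z₀ v₀
    have h2' : M * (‖z₀ - z'‖ * ‖v₀‖) ≤ M * (1 / 4 * 1) := by gcongr
    have h3' : M * (‖z'‖ * ‖v₀ - v'‖) ≤ M * (3 / 2 * (1 / 4)) := by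
      gcongr
      exact hs _ hz'
    have hMc : M ≤ 3 * c := by
      simp only at h1
      linarith
    exact (hmax z v).trans (by gcongr)

end Nets

/-! ### Frobenius geometry and orthonormal bases as matrices. -/

section Frobenius

theorem frobSq_nonneg {n m : ℕ} (A : Matrix (Fin n) (Fin m) ℝ) : 0 ≤ frobSq A :=
  Finset.sum_nonneg fun _ _ => Finset.sum_nonneg fun _ _ => sq_nonneg _

theorem frobSq_eq_trace {n m : ℕ} (A : Matrix (Fin n) (Fin m) ℝ) :
    frobSq A = (A.transpose * A).trace := by
  simp only [frobSq, Matrix.trace, Matrix.diag, Matrix.mul_apply, Matrix.transpose_apply]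
  rw [Finset.sum_comm]
  simp only [sq]

theorem frobSq_transpose {n m : ℕ} (A : Matrix (Fin n) (Fin m) ℝ) :
    frobSq A.transpose = frobSq A := by
  simp only [frobSq, Matrix.transpose_apply]
  exact Finset.sum_comm

theorem frobInner_add {n m : ℕ} (E A B : Matrix (Fin n) (Fin m) ℝ) :
    frobInner E (A + B) = frobInner E A + frobInner E B := by
  simp [frobInner, mul_add, Finset.sum_add_distrib]

theorem frobInner_smul {n m : ℕ} (E A : Matrix (Fin n) (Fin m) ℝ) (a : ℝ) :
    frobInner E (a • A) = a * frobInner E A := by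
  simp only [frobInner, Matrix.smul_apply, smul_eq_mul, Finset.mul_sum]
  exact Finset.sum_congr rfl fun _ _ => Finset.sum_congr rfl fun _ _ => by ring

theorem frobInner_neg_left {n m : ℕ} (E A : Matrix (Fin n) (Fin m) ℝ) :
    frobInner (-E) A = -frobInner E A := by
  simp [frobInner]

/-- Left multiplication by a matrix with orthonormal columns is a Frobenius isometry. -/
theorem frobSq_mul_of_orthonormal {n s m : ℕ} {Q : Matrix (Fin n) (Fin s) ℝ}
    (hQ : Q.transpose * Q = 1) (z : Matrix (Fin s) (Fin m) ℝ) : frobSq (Q * z) = frobSq z := by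
  rw [frobSq_eq_trace, frobSq_eq_trace, Matrix.transpose_mul, Matrix.mul_assoc,
    ← Matrix.mul_assoc Q.transpose, hQ, Matrix.one_mul]

/-- Pythagoras for the projection onto the span of orthonormal columns. -/
theorem frobSq_eq_add_of_orthonormal {n s m : ℕ} {Q : Matrix (Fin n) (Fin s) ℝ}
    (hQ : Q.transpose * Q = 1) (M : Matrix (Fin n) (Fin m) ℝ) :
    frobSq M = frobSq (Q.transpose * M) + frobSq (M - Q * (Q.transpose * M)) := by
  rw [frobSq_eq_trace, frobSq_eq_trace, frobSq_eq_trace, ← Matrix.trace_add]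
  congr 1
  have h : M.transpose * (Q * (Q.transpose * (Q * (Q.transpose * M))))
      = M.transpose * (Q * (Q.transpose * M)) := by
    rw [← Matrix.mul_assoc Q.transpose Q, hQ, Matrix.one_mul]
  simp only [Matrix.transpose_sub, Matrix.transpose_mul, Matrix.transpose_transpose,
    Matrix.sub_mul, Matrix.mul_sub, Matrix.mul_assoc, h]
  abel

theorem frobSq_transpose_mul_le {n s m : ℕ} {Q : Matrix (Fin n) (Fin s) ℝ}
    (hQ : Q.transpose * Q = 1) (M : Matrix (Fin n) (Fin m) ℝ) :
    frobSq (Q.transpose * M) ≤ frobSq M := by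
  rw [frobSq_eq_add_of_orthonormal hQ M]
  linarith [frobSq_nonneg (M - Q * (Q.transpose * M))]

/-- A subspace of `ℝⁿ` has an orthonormal basis, written as a matrix `Q`. -/
theorem exists_orthonormal_matrix {n : ℕ} (S : Submodule ℝ (Fin n → ℝ)) :
    ∃ Q : Matrix (Fin n) (Fin (Module.finrank ℝ S)) ℝ, Q.transpose * Q = 1 ∧
      ∀ {m : ℕ} (M : Matrix (Fin n) (Fin m) ℝ), (∀ j, (fun i => M i j) ∈ S) →
        Q * (Q.transpose * M) = M := by
  let e := (WithLp.linearEquiv 2 ℝ (Fin n → ℝ)).symm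
  let S' : Submodule ℝ (EuclideanSpace ℝ (Fin n)) := S.map e.toLinearMap
  have hfin : Module.finrank ℝ S' = Module.finrank ℝ S := LinearEquiv.finrank_map_eq e S
  let b := (stdOrthonormalBasis ℝ S').reindex (finCongr hfin)
  let Q : Matrix (Fin n) (Fin (Module.finrank ℝ S)) ℝ := Matrix.of fun i k => (b k : EuclideanSpace ℝ (Fin n)) i
  have hin : ∀ k (x : EuclideanSpace ℝ (Fin n)), inner ℝ (b k : EuclideanSpace ℝ (Fin n)) x
      = ∑ i, Q i k * x i := by
    intro k x
    rw [PiLp.inner_apply]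
    exact Finset.sum_congr rfl fun i _ => by simp [Q, mul_comm]
  refine ⟨Q, ?_, ?_⟩
  · ext k l
    rw [Matrix.mul_apply]
    simp only [Matrix.transpose_apply]
    have h1 := orthonormal_iff_ite.1 b.orthonormal k l
    rw [Submodule.coe_inner, hin] at h1
    rw [Matrix.one_apply]
    exact h1
  · intro m M hM
    ext i j
    have hx : WithLp.toLp 2 (fun i => M i j) ∈ S' := ⟨_, hM j, rfl⟩
    have h2 := congrArg (fun y : S' => (y : EuclideanSpace ℝ (Fin n)) i) (b.sum_repr' ⟨_, hx⟩)
    simp only [Submodule.coe_sum, Submodule.coe_smul, Submodule.coe_inner] at h2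
    rw [Matrix.mul_apply]
    simp only [Matrix.mul_apply, Matrix.transpose_apply]
    have h3 : (∑ k, (inner ℝ (b k : EuclideanSpace ℝ (Fin n)) (WithLp.toLp 2 fun i => M i j)) •
      (b k : EuclideanSpace ℝ (Fin n))) i = M i j := h2
    rw [← h3]
    simp only [WithLp.ofLp_sum, Finset.sum_apply, WithLp.ofLp_smul, Pi.smul_apply, smul_eq_mul, hin]
    exact Finset.sum_congr rfl fun k _ => by rw [mul_comm]; rfl

end Frobenius

/-! ### Nets for low-rank matrices. -/

section MatrixNets

open scoped Matrix.Norms.L2Operator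

/-- The C*-identity gives ‖V‖² = ‖V Vᵀ‖ = ‖1‖, which is 0 rather than 1 when r = 0. -/
theorem l2_opNorm_le_one_of_mul_transpose {r m : ℕ} {V : Matrix (Fin r) (Fin m) ℝ}
    (hV : V * V.transpose = 1) : ‖V‖ ≤ 1 := by
  have h := Matrix.l2_opNorm_conjTranspose_mul_self V.conjTranspose
  rw [Matrix.conjTranspose_conjTranspose, Matrix.l2_opNorm_conjTranspose,
    Matrix.conjTranspose_eq_transpose_of_trivial, hV, ← Matrix.diagonal_one,
    Matrix.l2_opNorm_diagonal] at h
  have h1 : ‖(fun _ => 1 : Fin r → ℝ)‖ ≤ 1 := (pi_norm_le_iff_of_nonneg zero_le_one).2 (by simp)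
  nlinarith [norm_nonneg V]

/-- Each row of `z * V` is Vᵀ applied to a row of z, and Vᵀ has the operator norm of V. -/
theorem frobSq_mul_le {s r m : ℕ} (z : Matrix (Fin s) (Fin r) ℝ) (V : Matrix (Fin r) (Fin m) ℝ) :
    frobSq (z * V) ≤ frobSq z * ‖V‖ ^ 2 := by
  simp only [frobSq, Finset.sum_mul _ _ (‖V‖ ^ 2)]
  refine Finset.sum_le_sum fun i _ => ?_
  have h := Matrix.l2_opNorm_mulVec V.conjTranspose (WithLp.toLp 2 (z i))
  rw [Matrix.l2_opNorm_conjTranspose, Matrix.conjTranspose_eq_transpose_of_trivial] at h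
  have h2 := pow_le_pow_left₀ (norm_nonneg _) h 2
  rw [mul_pow, EuclideanSpace.norm_sq_eq, EuclideanSpace.norm_sq_eq] at h2
  simp only [Real.norm_eq_abs, sq_abs, Matrix.mulVec_transpose] at h2
  rw [← Finset.sum_mul]
  calc _ ≤ _ := h2
    _ = _ := mul_comm _ _

/-- Vectors indexed by pairs, read as matrices. -/
def euclideanToMatrix (s r : ℕ) :
    EuclideanSpace ℝ (Fin s × Fin r) →ₗ[ℝ] Matrix (Fin s) (Fin r) ℝ where
  toFun := fun x => Matrix.of fun i j => x (i, j)
  map_add' := fun _ _ => rfl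
  map_smul' := fun _ _ => rfl

theorem frobSq_euclideanToMatrix {s r : ℕ} (x : EuclideanSpace ℝ (Fin s × Fin r)) :
    frobSq (euclideanToMatrix s r x) = ‖x‖ ^ 2 := by
  rw [EuclideanSpace.norm_sq_eq, Fintype.sum_prod_type]
  simp only [Real.norm_eq_abs, sq_abs]
  rfl

/-- Matrices `Q z V` with `Q` a fixed matrix with orthonormal columns, `z` in the Frobenius unit
ball and `V` with orthonormal rows: discretization of the supremum of a linear functional. -/
theorem exists_lowRank_net {n s : ℕ} (r m : ℕ) {Q : Matrix (Fin n) (Fin s) ℝ}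
    (hQ : Q.transpose * Q = 1) :
    ∃ N : Finset (Matrix (Fin n) (Fin m) ℝ), N.card ≤ 25 ^ (s * r + r * m) ∧
      (∀ W ∈ N, frobSq W < 9) ∧
      ∀ (E : Matrix (Fin n) (Fin m) ℝ) (c : ℝ), 0 ≤ c → (∀ W ∈ N, frobInner E W ≤ c) →
        ∀ (z : Matrix (Fin s) (Fin r) ℝ) (V : Matrix (Fin r) (Fin m) ℝ), V * V.transpose = 1 →
          frobInner E (Q * z * V) ≤ 3 * c * Real.sqrt (frobSq z) := by
  classical
  let mat := euclideanToMatrix s r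
  have hmat : ∀ x, frobSq (mat x) = ‖x‖ ^ 2 := frobSq_euclideanToMatrix
  -- QzV is bilinear in (z, V). Measuring z in Frobenius norm and V in operator norm puts every V
  -- with orthonormal rows in the unit ball, whatever r is; the net size depends only on the
  -- dimensions.
  obtain ⟨N, hcard, hN, hnet⟩ :=
    exists_bilin_net (EuclideanSpace ℝ (Fin s × Fin r)) (Matrix (Fin r) (Fin m) ℝ)
  refine ⟨N.image fun x => Q * mat x.1 * x.2, ?_, ?_, ?_⟩
  · refine Finset.card_image_le.trans (hcard.trans (le_of_eq ?_))
    rw [finrank_euclideanSpace, Module.finrank_matrix]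
    simp
  · intro W hW
    obtain ⟨x, hx, rfl⟩ := Finset.mem_image.1 hW
    obtain ⟨h1, h2⟩ := hN x hx
    rw [Matrix.mul_assoc, frobSq_mul_of_orthonormal hQ]
    refine (frobSq_mul_le _ _).trans_lt ?_
    rw [hmat]
    calc ‖x.1‖ ^ 2 * ‖x.2‖ ^ 2 ≤ (3 / 2) ^ 2 * (3 / 2) ^ 2 := by gcongr
      _ < 9 := by norm_num
  · intro E c hc₀ hc z V hV
    let β : EuclideanSpace ℝ (Fin s × Fin r) →ₗ[ℝ] Matrix (Fin r) (Fin m) ℝ →ₗ[ℝ] ℝ :=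
      LinearMap.mk₂ ℝ (fun x V => frobInner E (Q * mat x * V))
        (fun x y V => by simp only [map_add, Matrix.mul_add, Matrix.add_mul, frobInner_add])
        (fun a x V => by
          simp only [map_smul, Matrix.mul_smul, Matrix.smul_mul, frobInner_smul, smul_eq_mul])
        (fun x V W => by simp only [Matrix.mul_add, frobInner_add])
        (fun a x V => by simp only [Matrix.mul_smul, frobInner_smul, smul_eq_mul])
    let x : EuclideanSpace ℝ (Fin s × Fin r) := WithLp.toLp 2 fun ij => z ij.1 ij.2
    have hx : mat x = z := rfl
    have hxn : ‖x‖ = Real.sqrt (frobSq z) := by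
      rw [← hx, hmat, Real.sqrt_sq (norm_nonneg _)]
    have hVn := l2_opNorm_le_one_of_mul_transpose hV
    have h1 : frobInner E (Q * z * V) ≤ 3 * c * (‖x‖ * ‖V‖) :=
      hnet β c (fun y hy => hc _ (Finset.mem_image_of_mem _ hy)) x V
    rw [hxn] at h1
    refine h1.trans ?_
    gcongr
    exact mul_le_of_le_one_right (Real.sqrt_nonneg _) hVn

/-- Matrices `Q z` with `Q` a fixed matrix with orthonormal columns and `z` in the Frobenius unit
ball: discretization of the supremum of a linear functional. -/
theorem exists_columnSpace_net {n s : ℕ} (m : ℕ) {Q : Matrix (Fin n) (Fin s) ℝ}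
    (hQ : Q.transpose * Q = 1) :
    ∃ N : Finset (Matrix (Fin n) (Fin m) ℝ), N.card ≤ 25 ^ (s * m + 1) ∧
      (∀ W ∈ N, frobSq W < 9) ∧
      ∀ (E : Matrix (Fin n) (Fin m) ℝ) (c : ℝ), (∀ W ∈ N, frobInner E W ≤ c) →
        ∀ z : Matrix (Fin s) (Fin m) ℝ, frobInner E (Q * z) ≤ 3 * c * Real.sqrt (frobSq z) := by
  classical
  let mat := euclideanToMatrix s m
  -- A linear functional is treated as a bilinear form with second factor ℝ, which accounts for the
  -- + 1 in the exponent.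
  obtain ⟨N, hcard, hN, hnet⟩ := exists_bilin_net (EuclideanSpace ℝ (Fin s × Fin m)) ℝ
  refine ⟨N.image fun x => x.2 • (Q * mat x.1), ?_, ?_, ?_⟩
  · refine Finset.card_image_le.trans (hcard.trans (le_of_eq ?_))
    rw [finrank_euclideanSpace]
    simp
  · intro W hW
    obtain ⟨x, hx, rfl⟩ := Finset.mem_image.1 hW
    obtain ⟨h1, h2⟩ := hN x hx
    rw [← Matrix.mul_smul, frobSq_mul_of_orthonormal hQ, ← map_smul, frobSq_euclideanToMatrix,
      norm_smul, mul_pow]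
    calc ‖x.2‖ ^ 2 * ‖x.1‖ ^ 2 ≤ (3 / 2) ^ 2 * (3 / 2) ^ 2 := by gcongr
      _ < 9 := by norm_num
  · intro E c hc z
    let β : EuclideanSpace ℝ (Fin s × Fin m) →ₗ[ℝ] ℝ →ₗ[ℝ] ℝ :=
      LinearMap.mk₂ ℝ (fun x t => frobInner E (t • (Q * mat x)))
        (fun x y V => by simp only [map_add, Matrix.mul_add, smul_add, frobInner_add])
        (fun a x V => by
          simp only [map_smul, Matrix.mul_smul, frobInner_smul, smul_eq_mul]; ring)
        (fun x V W => by simp only [add_smul, frobInner_add])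
        (fun a x V => by simp only [frobInner_smul, smul_eq_mul]; ring)
    let x : EuclideanSpace ℝ (Fin s × Fin m) := WithLp.toLp 2 fun ij => z ij.1 ij.2
    have hx : mat x = z := rfl
    have hxn : ‖x‖ = Real.sqrt (frobSq z) := by
      rw [← hx, frobSq_euclideanToMatrix, Real.sqrt_sq (norm_nonneg _)]
    have h1 : frobInner E ((1 : ℝ) • (Q * z)) ≤ 3 * c * (‖x‖ * ‖(1 : ℝ)‖) :=
      hnet β c (fun y hy => hc _ (Finset.mem_image_of_mem _ hy)) x 1
    rwa [one_smul, norm_one, mul_one, hxn] at h1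

end MatrixNets

/-! ### Exponential square moments of the noise. -/

section SubGaussian

variable {Ω : Type*} [MeasurableSpace Ω] {μ : Measure Ω}

/-- Strictness provides an admissible u < t, so the infimum need not be attained, and the integrand
decreases in the scale. -/
theorem lintegral_exp_sq_le_of_psi2Norm_lt {Z : Ω → ℝ} {t : ℝ} (ht : 0 < t)
    (h : psi2Norm μ Z < ENNReal.ofReal t) :
    ∫⁻ ω, ENNReal.ofReal (Real.exp ((Z ω / t) ^ 2)) ∂μ ≤ 2 := by
  obtain ⟨_, ⟨u, hu, hint, rfl⟩, hut⟩ := sInf_lt_iff.1 h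
  have hut' : u < t := (ENNReal.ofReal_lt_ofReal_iff ht).1 hut
  refine (lintegral_mono fun ω => ENNReal.ofReal_le_ofReal (Real.exp_le_exp.2 ?_)).trans hint
  rw [div_pow, div_pow]
  gcongr

/-- Since Z² ≤ t² exp((Z/t)²), the second moment is at most 2t² for every t > 0. -/
theorem ae_eq_zero_of_psi2Norm_eq_zero {Z : Ω → ℝ} (hZ : AEMeasurable Z μ)
    (h : psi2Norm μ Z = 0) : ∀ᵐ ω ∂μ, Z ω = 0 := by
  have hbound : ∀ t : ℝ, 0 < t → ∫⁻ ω, ENNReal.ofReal (Z ω ^ 2) ∂μ ≤ ENNReal.ofReal (t ^ 2) * 2 := by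
    intro t ht
    have h1 := lintegral_exp_sq_le_of_psi2Norm_lt (μ := μ) (Z := Z) ht (by simpa [h] using ht)
    calc ∫⁻ ω, ENNReal.ofReal (Z ω ^ 2) ∂μ
        ≤ ∫⁻ ω, ENNReal.ofReal (t ^ 2) * ENNReal.ofReal (Real.exp ((Z ω / t) ^ 2)) ∂μ := by
          refine lintegral_mono fun ω => ?_
          rw [← ENNReal.ofReal_mul (by positivity)]
          refine ENNReal.ofReal_le_ofReal ?_
          have h2 := Real.add_one_le_exp ((Z ω / t) ^ 2)
          calc Z ω ^ 2 = t ^ 2 * (Z ω / t) ^ 2 := by field_simp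
            _ ≤ _ := by gcongr; linarith
      _ = ENNReal.ofReal (t ^ 2) * ∫⁻ ω, ENNReal.ofReal (Real.exp ((Z ω / t) ^ 2)) ∂μ :=
          lintegral_const_mul' _ _ ENNReal.ofReal_ne_top
      _ ≤ _ := by gcongr
  have hzero : ∫⁻ ω, ENNReal.ofReal (Z ω ^ 2) ∂μ = 0 := by
    refine le_antisymm (ENNReal.le_of_forall_pos_le_add fun ε hε _ => ?_) zero_le
    refine (hbound (Real.sqrt (ε / 2)) (by positivity)).trans ?_
    rw [Real.sq_sqrt (by positivity), zero_add, ← ENNReal.ofReal_ofNat, ← ENNReal.ofReal_mul (by positivity)]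
    simp
  rw [lintegral_eq_zero_iff' (by fun_prop)] at hzero
  filter_upwards [hzero] with ω hω
  have h3 : Z ω ^ 2 ≤ 0 := by simpa using hω
  exact pow_eq_zero_iff (two_ne_zero) |>.1 (le_antisymm h3 (sq_nonneg _))

variable {n m : ℕ} {E : Ω → Matrix (Fin n) (Fin m) ℝ} {σ : ℝ}

theorem IsCenteredSubGaussian.aemeasurable_frobInner (hE : IsCenteredSubGaussian μ E σ)
    (W : Matrix (Fin n) (Fin m) ℝ) : AEMeasurable (fun ω => frobInner (E ω) W) μ := by
  unfold frobInner
  exact Finset.aemeasurable_fun_sum _ fun i _ => Finset.aemeasurable_fun_sum _ fun j _ =>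
    (hE.aemeasurable i j).mul_const _

theorem IsCenteredSubGaussian.ae_eq_zero (hE : IsCenteredSubGaussian μ E 0) :
    ∀ᵐ ω ∂μ, E ω = 0 := by
  have h : ∀ i j, ∀ᵐ ω ∂μ, E ω i j = 0 := by
    intro i j
    refine ae_eq_zero_of_psi2Norm_eq_zero (hE.aemeasurable i j) ?_
    have h1 := hE.psi2_le (Matrix.single i j 1)
    have h2 : (fun ω => frobInner (E ω) (Matrix.single i j 1)) = fun ω => E ω i j := by
      funext ω
      simp [frobInner, Matrix.single_apply, ite_and, Finset.sum_ite_eq]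
    rw [h2] at h1
    simpa using h1
  filter_upwards [ae_all_iff.2 fun i => ae_all_iff.2 (h i)] with ω hω
  ext i j
  exact hω i j

/-- The exponential sum of squares of the linear functional `⟨E, ·⟩` over a finite set. -/
noncomputable def expSqSum (σ : ℝ) (N : Finset (Matrix (Fin n) (Fin m) ℝ))
    (E : Matrix (Fin n) (Fin m) ℝ) : ℝ :=
  ∑ W ∈ N, Real.exp ((frobInner E W / (3 * σ)) ^ 2)

theorem expSqSum_nonneg (σ : ℝ) (N : Finset (Matrix (Fin n) (Fin m) ℝ))
    (E : Matrix (Fin n) (Fin m) ℝ) : 0 ≤ expSqSum σ N E :=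
  Finset.sum_nonneg fun _ _ => (Real.exp_pos _).le

theorem IsCenteredSubGaussian.aemeasurable_expSqSum (hE : IsCenteredSubGaussian μ E σ)
    (N : Finset (Matrix (Fin n) (Fin m) ℝ)) : AEMeasurable (fun ω => expSqSum σ N (E ω)) μ := by
  unfold expSqSum
  refine Finset.aemeasurable_fun_sum _ fun W _ => ?_
  have := hE.aemeasurable_frobInner W
  fun_prop

theorem IsCenteredSubGaussian.lintegral_expSqSum_le (hE : IsCenteredSubGaussian μ E σ)
    (hσ : 0 < σ) {N : Finset (Matrix (Fin n) (Fin m) ℝ)} (hN : ∀ W ∈ N, frobSq W < 9) :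
    ∫⁻ ω, ENNReal.ofReal (expSqSum σ N (E ω)) ∂μ ≤ ENNReal.ofReal (2 * N.card) := by
  have hone : ∀ W ∈ N,
      ∫⁻ ω, ENNReal.ofReal (Real.exp ((frobInner (E ω) W / (3 * σ)) ^ 2)) ∂μ ≤ 2 := by
    intro W hW
    -- ‖W‖_F < 3 makes the ψ₂ norm strictly smaller than the scale 3σ.
    refine lintegral_exp_sq_le_of_psi2Norm_lt (by positivity) ((hE.psi2_le W).trans_lt ?_)
    rw [ENNReal.ofReal_lt_ofReal_iff (by positivity), mul_comm]
    gcongr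
    rw [Real.sqrt_lt' (by norm_num)]
    linarith [hN W hW]
  calc ∫⁻ ω, ENNReal.ofReal (expSqSum σ N (E ω)) ∂μ
      = ∑ W ∈ N, ∫⁻ ω, ENNReal.ofReal (Real.exp ((frobInner (E ω) W / (3 * σ)) ^ 2)) ∂μ := by
        rw [← lintegral_finsetSum']
        · refine lintegral_congr fun ω => ?_
          exact ENNReal.ofReal_sum_of_nonneg fun _ _ => (Real.exp_pos _).le
        · intro W _
          have := hE.aemeasurable_frobInner W
          fun_prop
    _ ≤ ∑ W ∈ N, 2 := Finset.sum_le_sum hone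
    _ = ENNReal.ofReal (2 * N.card) := by
        rw [Finset.sum_const, nsmul_eq_mul, ENNReal.ofReal_mul (by norm_num), mul_comm]
        simp

/-- One term is at most the whole sum, and R ≤ exp R moves the random factor into the exponent. -/
theorem frobInner_le_of_expSqSum_le (hσ : 0 < σ) {N : Finset (Matrix (Fin n) (Fin m) ℝ)}
    {E : Matrix (Fin n) (Fin m) ℝ} {L R : ℝ} (h : expSqSum σ N E ≤ Real.exp L * R)
    {W : Matrix (Fin n) (Fin m) ℝ} (hW : W ∈ N) :
    frobInner E W ≤ 3 * σ * Real.sqrt (L + R) := by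
  have h1 : Real.exp ((frobInner E W / (3 * σ)) ^ 2) ≤ Real.exp (L + R) := by
    calc Real.exp ((frobInner E W / (3 * σ)) ^ 2) ≤ expSqSum σ N E :=
          Finset.single_le_sum (f := fun W => Real.exp ((frobInner E W / (3 * σ)) ^ 2))
            (fun _ _ => (Real.exp_pos _).le) hW
      _ ≤ Real.exp L * R := h
      _ ≤ Real.exp L * Real.exp R := by
          gcongr
          linarith [Real.add_one_le_exp R]
      _ = _ := (Real.exp_add _ _).symm
  have h2 := Real.abs_le_sqrt (Real.exp_le_exp.1 h1)
  have h3 := (le_abs_self _).trans h2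
  rwa [div_le_iff₀' (by positivity)] at h3

end SubGaussian

/-! ### Counting the partitions of the rows. -/

section RowPatterns

/-- Codes for the partitions of `Fin (p + 1)`: a set `J ∌ 0` such that `insert 0 J` is a set of
representatives, and the map that sends every index to its representative. -/
def rowPatterns (p : ℕ) : Finset (Σ _ : Finset (Fin (p + 1)), Fin (p + 1) → Fin (p + 1)) :=
  (Finset.univ.erase 0).powerset.sigma fun J =>
    Fintype.piFinset fun i => if i ∈ insert 0 J then {i} else insert 0 J

theorem card_insert_zero {p : ℕ} {J : Finset (Fin (p + 1))}
    (hJ : J ∈ (Finset.univ.erase 0).powerset) : (insert 0 J).card = J.card + 1 := by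
  refine Finset.card_insert_of_notMem fun h => ?_
  simpa using Finset.mem_powerset.1 hJ h

theorem mem_insert_of_rowPatterns {p : ℕ}
    {x : Σ _ : Finset (Fin (p + 1)), Fin (p + 1) → Fin (p + 1)} (hx : x ∈ rowPatterns p)
    (i : Fin (p + 1)) : x.2 i ∈ insert 0 x.1 := by
  have h := Fintype.mem_piFinset.1 (Finset.mem_sigma.1 hx).2 i
  split_ifs at h with hi
  · rw [Finset.mem_singleton.1 h]
    exact hi
  · exact h

theorem card_le_of_rowPatterns {p : ℕ}
    {x : Σ _ : Finset (Fin (p + 1)), Fin (p + 1) → Fin (p + 1)} (hx : x ∈ rowPatterns p) :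
    x.1.card ≤ p := by
  have h := Finset.card_le_card (Finset.mem_powerset.1 (Finset.mem_sigma.1 hx).1)
  simpa using h

/-- Raising k by one multiplies the binomial coefficient by (j + k + 1)/(k + 1) ≤ j + 1. -/
theorem choose_le_succ_pow (j k : ℕ) : (j + k).choose j ≤ (j + 1) ^ k := by
  induction k with
  | zero => simp
  | succ k ih =>
    have h : (j + k + 1).choose j * (k + 1) = (j + k).choose j * (j + k + 1) := by
      have h1 := Nat.add_one_mul_choose_eq (j + k) k
      rw [← Nat.choose_symm_add, add_assoc j k 1, ← Nat.choose_symm_add] at h1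
      rw [add_assoc, ← h1, mul_comm]
    have h3 : j + k + 1 ≤ (j + 1) * (k + 1) := by nlinarith [Nat.zero_le (j * k)]
    have h4 : (j + k + 1).choose j * (k + 1) ≤ (j + 1) ^ (k + 1) * (k + 1) := by
      rw [h, pow_succ, mul_assoc]
      exact Nat.mul_le_mul ih h3
    exact Nat.le_of_mul_le_mul_right h4 (Nat.succ_pos k)

/-- The term j = 0 equals 1; the others have base at least 2 and are dominated by a geometric series
of sum at most 2. -/
theorem sum_inv_succ_pow_le (p : ℕ) :
    ∑ j ∈ Finset.range (p + 1), (((j : ℝ) + 1) ^ (p - j))⁻¹ ≤ 3 := by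
  rw [Finset.sum_range_succ']
  have h1 : ∑ j ∈ Finset.range p, ((((j + 1 : ℕ) : ℝ) + 1) ^ (p - (j + 1)))⁻¹
      ≤ ∑ j ∈ Finset.range p, (1 / 2 : ℝ) ^ (p - 1 - j) := by
    refine Finset.sum_le_sum fun j _ => ?_
    rw [show p - (j + 1) = p - 1 - j by omega, one_div, inv_pow]
    gcongr
    push_cast
    linarith [(Nat.cast_nonneg j : (0 : ℝ) ≤ j)]
  rw [Finset.sum_range_reflect (fun j => (1 / 2 : ℝ) ^ j)] at h1
  have h2 := sum_geometric_two_le p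
  have h3 : (((((0 : ℕ) : ℝ) + 1) ^ (p - 0))⁻¹ : ℝ) = 1 := by simp
  linarith

/-- Put u = (j + 1)^(p - j). There are at most u sets J of size j, each with u maps, so the weight
u⁻³ leaves the summable u⁻¹. -/
theorem sum_rowPatterns_le (p : ℕ) :
    ∑ x ∈ rowPatterns p, Real.exp (-(3 * (((p : ℝ) - x.1.card) * Real.log (x.1.card + 1)))) ≤ 3 := by
  rw [rowPatterns, Finset.sum_sigma]
  let g : ℕ → ℝ := fun j => ((j : ℝ) + 1) ^ (p - j) *
    Real.exp (-(3 * (((p : ℝ) - j) * Real.log (j + 1))))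
  have hg : ∀ J ∈ (Finset.univ.erase (0 : Fin (p + 1))).powerset,
      ∑ _f ∈ Fintype.piFinset (fun i => if i ∈ insert 0 J then {i} else insert 0 J),
        Real.exp (-(3 * (((p : ℝ) - J.card) * Real.log (J.card + 1)))) = g J.card := by
    intro J hJ
    rw [Finset.sum_const, Fintype.card_piFinset, nsmul_eq_mul]
    congr 1
    have h1 : ∀ i, (if i ∈ insert 0 J then {i} else insert 0 J : Finset (Fin (p + 1))).card
        = if i ∈ insert 0 J then 1 else J.card + 1 := by
      intro i
      split_ifs
      · simp
      · exact card_insert_zero hJ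
    simp only [h1]
    rw [Finset.prod_ite]
    simp only [Finset.prod_const, one_pow, one_mul]
    have h2 : (Finset.univ.filter fun i => i ∉ insert 0 J).card = p - J.card := by
      rw [← Finset.compl_filter, Finset.card_compl]
      simp only [Finset.filter_mem_eq_inter, Finset.univ_inter, Fintype.card_fin,
        card_insert_zero hJ]
      omega
    rw [h2]
    push_cast
    rfl
  rw [Finset.sum_congr rfl hg, Finset.sum_powerset_apply_card]
  simp only [Finset.card_erase_of_mem (Finset.mem_univ _), Finset.card_univ, Fintype.card_fin,
    Nat.add_sub_cancel, nsmul_eq_mul]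
  refine (Finset.sum_le_sum fun j hj => ?_).trans (sum_inv_succ_pow_le p)
  have hjp : j ≤ p := Nat.lt_succ_iff.1 (Finset.mem_range.1 hj)
  have hpos : (0 : ℝ) < (j : ℝ) + 1 := by positivity
  have hexp : Real.exp (-(3 * (((p : ℝ) - j) * Real.log (j + 1))))
      = ((((j : ℝ) + 1) ^ (p - j)) ^ 3)⁻¹ := by
    rw [Real.exp_neg, ← Nat.cast_sub hjp, ← Real.log_pow,
      show (3 : ℝ) * Real.log (((j : ℝ) + 1) ^ (p - j))
        = ((3 : ℕ) : ℝ) * Real.log (((j : ℝ) + 1) ^ (p - j)) by norm_num, ← Real.log_pow,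
      Real.exp_log (by positivity)]
  have hch : (p.choose j : ℝ) ≤ ((j : ℝ) + 1) ^ (p - j) := by
    have := choose_le_succ_pow j (p - j)
    rw [Nat.add_sub_cancel' hjp] at this
    exact_mod_cast this
  simp only [g, hexp]
  set u := ((j : ℝ) + 1) ^ (p - j)
  have hu : 0 < u := by positivity
  calc (p.choose j : ℝ) * (u * (u ^ 3)⁻¹) ≤ u * (u * (u ^ 3)⁻¹) := by gcongr
    _ = u⁻¹ := by field_simp

/-- Every index is sent to the least index of its class, so 0 is always a representative and need
not be chosen. This matters: with a single class the penalty (p - q) log q vanishes and pays for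
only one code, not for p + 1 choices of a representative. -/
theorem exists_rowPattern {p m : ℕ} (B : Matrix (Fin (p + 1)) (Fin m) ℝ) :
    ∃ x ∈ rowPatterns p, x.1.card + 1 = numDistinctRows B ∧ ∀ i, B (x.2 i) = B i := by
  classical
  let cl : Fin (p + 1) → Finset (Fin (p + 1)) := fun i => Finset.univ.filter fun j => B j = B i
  have hcl : ∀ i, (cl i).Nonempty := fun i => ⟨i, by simp [cl]⟩
  let f : Fin (p + 1) → Fin (p + 1) := fun i => (cl i).min' (hcl i)
  have hf : ∀ i, B (f i) = B i := fun i => by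
    have := (cl i).min'_mem (hcl i)
    exact (Finset.mem_filter.1 this).2
  have hfeq : ∀ i j, B i = B j → f i = f j := by
    intro i j h
    have : cl i = cl j := by simp [cl, h]
    simp only [f, this]
  have hff : ∀ i, f (f i) = f i := fun i => hfeq _ _ (hf i)
  have hf0 : f 0 = 0 := le_antisymm ((cl 0).min'_le 0 (by simp [cl])) (Fin.zero_le _)
  let I := Finset.univ.image f
  have h0I : 0 ∈ I := Finset.mem_image.2 ⟨0, Finset.mem_univ _, hf0⟩
  have hI : insert 0 (I.erase 0) = I := Finset.insert_erase h0I
  refine ⟨⟨I.erase 0, f⟩, ?_, ?_, hf⟩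
  · refine Finset.mem_sigma.2 ⟨?_, ?_⟩
    · exact Finset.mem_powerset.2 (Finset.erase_subset_erase _ (Finset.subset_univ _))
    · rw [Fintype.mem_piFinset]
      intro i
      simp only [hI]
      split_ifs with hi
      · obtain ⟨k, -, rfl⟩ := Finset.mem_image.1 hi
        exact Finset.mem_singleton.2 (hff k)
      · exact Finset.mem_image_of_mem _ (Finset.mem_univ _)
  · simp only
    rw [Finset.card_erase_add_one h0I, numDistinctRows]
    have hr : (Set.range fun i => B i) = ((I.image fun i => B i : Finset (Fin m → ℝ)) : Set (Fin m → ℝ)) := by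
      ext v
      simp only [Set.mem_range, Finset.coe_image, Set.mem_image, Finset.mem_coe]
      constructor
      · rintro ⟨i, rfl⟩
        exact ⟨f i, Finset.mem_image_of_mem _ (Finset.mem_univ _), hf i⟩
      · rintro ⟨i, -, rfl⟩
        exact ⟨i, rfl⟩
    rw [hr, Set.ncard_coe_finset]
    refine (Finset.card_image_of_injOn ?_).symm
    intro i hi j hj hij
    obtain ⟨k, -, rfl⟩ := Finset.mem_image.1 hi
    obtain ⟨l, -, rfl⟩ := Finset.mem_image.1 hj
    rw [← hff k, ← hff l]
    exact hfeq _ _ hij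

/-- The space of the vectors `X v` with `v` constant along the fibres of `f`. -/
noncomputable def patternSpace {n p : ℕ} (X : Matrix (Fin n) (Fin p) ℝ) (f : Fin p → Fin p) :
    Submodule ℝ (Fin n → ℝ) :=
  (LinearMap.range (LinearMap.funLeft ℝ ℝ f)).map X.mulVecLin

/-- The space is the image under X of the span of the indicators of the fibres over I, and it lies
in the column space of X. -/
theorem finrank_patternSpace_le {n p : ℕ} (X : Matrix (Fin n) (Fin p) ℝ) {f : Fin p → Fin p}
    {I : Finset (Fin p)} (hf : ∀ i, f i ∈ I) :
    Module.finrank ℝ (patternSpace X f) ≤ min I.card X.rank := by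
  classical
  refine le_min ?_ ?_
  · refine (Submodule.finrank_map_le _ _).trans ?_
    let ind : Fin p → Fin p → ℝ := fun k i => if f i = k then 1 else 0
    have hsub : LinearMap.range (LinearMap.funLeft ℝ ℝ f) ≤
        Submodule.span ℝ ((I.image ind : Finset (Fin p → ℝ)) : Set (Fin p → ℝ)) := by
      rintro _ ⟨v, rfl⟩
      have : LinearMap.funLeft ℝ ℝ f v = ∑ k ∈ I, v k • ind k := by
        funext i
        simp [LinearMap.funLeft_apply, ind, hf i]
      rw [this]
      exact Submodule.sum_mem _ fun k hk => Submodule.smul_mem _ _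
        (Submodule.subset_span (Finset.mem_coe.2 (Finset.mem_image_of_mem _ hk)))
    exact (Submodule.finrank_mono hsub).trans
      ((finrank_span_finset_le_card _).trans Finset.card_image_le)
  · exact Submodule.finrank_mono (by
      rintro _ ⟨v, -, rfl⟩
      exact ⟨v, rfl⟩)

theorem mul_col_mem_patternSpace {n p m : ℕ} (X : Matrix (Fin n) (Fin p) ℝ) {f : Fin p → Fin p}
    {B : Matrix (Fin p) (Fin m) ℝ} (hB : ∀ i, B (f i) = B i) (j : Fin m) :
    (fun i => (X * B) i j) ∈ patternSpace X f := by
  refine ⟨fun i => B i j, ⟨fun i => B i j, ?_⟩, rfl⟩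
  funext i
  exact congrFun (hB i) j

end RowPatterns

/-! ### Splitting the prediction difference. -/

section Decomposition

/-- The row space of `B` has an orthonormal basis, written as the rows of a matrix `V`. -/
theorem exists_rowSpace_basis {p m : ℕ} (B : Matrix (Fin p) (Fin m) ℝ) :
    ∃ V : Matrix (Fin B.rank) (Fin m) ℝ, V * V.transpose = 1 ∧ B * V.transpose * V = B := by
  -- The construction yields the rank of Bᵀ; a general k avoids a transport of V along
  -- `B.rank_transpose`.
  have key : ∀ k, Module.finrank ℝ (LinearMap.range B.transpose.mulVecLin) = k →
      ∃ V : Matrix (Fin k) (Fin m) ℝ, V * V.transpose = 1 ∧ B * V.transpose * V = B := by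
    rintro _ rfl
    obtain ⟨Q, hQ, hproj⟩ := exists_orthonormal_matrix (LinearMap.range B.transpose.mulVecLin)
    refine ⟨Q.transpose, by rwa [Matrix.transpose_transpose], ?_⟩
    have h := hproj B.transpose fun j =>
      ⟨Pi.single j 1, by rw [Matrix.mulVecLin_apply, Matrix.mulVec_single_one]; rfl⟩
    have h' := congrArg Matrix.transpose h
    simpa [Matrix.transpose_mul] using h'
  exact key _ (B.rank_transpose)

theorem mul_col_mem_range {n m k : ℕ} (G : Matrix (Fin n) (Fin m) ℝ) (M : Matrix (Fin m) (Fin k) ℝ)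
    (j : Fin k) : (fun i => (G * M) i j) ∈ LinearMap.range G.mulVecLin :=
  ⟨fun i => M i j, rfl⟩

/-- A difference `U - G`, where the rows of `U` lie in the row space of `V`, splits into a part
with rows in that space and a part with columns in the column space of `G`. -/
theorem exists_split {n m r s t : ℕ} {U G : Matrix (Fin n) (Fin m) ℝ}
    {Q : Matrix (Fin n) (Fin s) ℝ} {Q' : Matrix (Fin n) (Fin t) ℝ} {V : Matrix (Fin r) (Fin m) ℝ}
    (hQ : Q.transpose * Q = 1) (hQ' : Q'.transpose * Q' = 1) (hV : V * V.transpose = 1)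
    (hUV : U * V.transpose * V = U) (hQU : Q * (Q.transpose * (U - G)) = U - G)
    (hQG : ∀ M : Matrix (Fin m) (Fin m) ℝ, Q' * (Q'.transpose * (G * M)) = G * M) :
    ∃ (z : Matrix (Fin s) (Fin r) ℝ) (z' : Matrix (Fin t) (Fin m) ℝ),
      U - G = Q * z * V + Q' * z' ∧ frobSq z ≤ frobSq (U - G) ∧ frobSq z' ≤ frobSq (U - G) := by
  set T := U - G with hT
  have hVt : V.transpose.transpose * V.transpose = 1 := by rwa [Matrix.transpose_transpose]
  -- VᵀV fixes the rows of U, so what the projection removes from T comes from G alone. Both parts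
  -- are projections of T, hence no larger in Frobenius norm.
  have hT2 : T - T * V.transpose * V = G * (V.transpose * V - 1) := by
    rw [hT, Matrix.sub_mul, Matrix.sub_mul, hUV, Matrix.mul_sub, Matrix.mul_one, Matrix.mul_assoc]
    abel
  refine ⟨Q.transpose * (T * V.transpose), Q'.transpose * (T - T * V.transpose * V), ?_, ?_, ?_⟩
  · have h1 : Q * (Q.transpose * (T * V.transpose)) = T * V.transpose := by
      rw [← Matrix.mul_assoc Q.transpose, ← Matrix.mul_assoc Q, hQU]
    rw [h1, hT2, hQG, ← hT2]
    abel
  · refine (frobSq_transpose_mul_le hQ _).trans ?_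
    rw [← frobSq_transpose (T * V.transpose), Matrix.transpose_mul, ← frobSq_transpose T]
    exact frobSq_transpose_mul_le hVt _
  · refine (frobSq_transpose_mul_le hQ' _).trans ?_
    have h := frobSq_eq_add_of_orthonormal hVt T.transpose
    rw [← frobSq_transpose (T - _), ← frobSq_transpose T, h]
    have h2 : (T - T * V.transpose * V).transpose
        = T.transpose - V.transpose * (V.transpose.transpose * T.transpose) := by
      simp [Matrix.transpose_mul]
    rw [h2]
    linarith [frobSq_nonneg (V.transpose.transpose * T.transpose)]

end Decomposition

/-! ### Uniform control of the noise. -/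

section Stochastic

variable {Ω : Type*} [MeasurableSpace Ω] {μ : Measure Ω} {n m : ℕ}
  {E : Ω → Matrix (Fin n) (Fin m) ℝ} {σ : ℝ}

theorem IsCenteredSubGaussian.lintegral_sum_expSqSum_le {ι : Type*}
    (hE : IsCenteredSubGaussian μ E σ) (hσ : 0 < σ) (t : Finset ι) (w : ι → ℝ) (hw : ∀ i, 0 ≤ w i)
    {N : ι → Finset (Matrix (Fin n) (Fin m) ℝ)} (hN : ∀ i, ∀ W ∈ N i, frobSq W < 9) :
    ∫⁻ ω, ENNReal.ofReal (∑ i ∈ t, w i * expSqSum σ (N i) (E ω)) ∂μ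
      ≤ ENNReal.ofReal (∑ i ∈ t, w i * (2 * (N i).card)) := by
  calc ∫⁻ ω, ENNReal.ofReal (∑ i ∈ t, w i * expSqSum σ (N i) (E ω)) ∂μ
      = ∑ i ∈ t, ∫⁻ ω, ENNReal.ofReal (w i) * ENNReal.ofReal (expSqSum σ (N i) (E ω)) ∂μ := by
        rw [← lintegral_finsetSum']
        · refine lintegral_congr fun ω => ?_
          rw [ENNReal.ofReal_sum_of_nonneg fun i _ => mul_nonneg (hw i) (expSqSum_nonneg _ _ _)]
          exact Finset.sum_congr rfl fun i _ => ENNReal.ofReal_mul (hw i)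
        · intro i _
          have := hE.aemeasurable_expSqSum (N i)
          fun_prop
    _ ≤ ∑ i ∈ t, ENNReal.ofReal (w i * (2 * (N i).card)) := by
        refine Finset.sum_le_sum fun i _ => ?_
        rw [lintegral_const_mul' _ _ ENNReal.ofReal_ne_top, ENNReal.ofReal_mul (hw i)]
        gcongr
        exact hE.lintegral_expSqSum_le hσ (hN i)
    _ = _ := (ENNReal.ofReal_sum_of_nonneg fun i _ => mul_nonneg (hw i) (by positivity)).symm

theorem pow_twentyFive_le_exp (k : ℕ) : ((25 ^ k : ℕ) : ℝ) ≤ Real.exp (4 * k) := by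
  have h : (25 : ℝ) ≤ Real.exp 4 := by
    have h1 := Real.exp_one_gt_d9
    have h2 : Real.exp 4 = Real.exp 1 ^ 4 := by rw [← Real.exp_nat_mul]; norm_num
    rw [h2]
    calc (25 : ℝ) ≤ (27 / 10) ^ 4 := by norm_num
      _ ≤ _ := by gcongr; linarith
  rw [mul_comm, Real.exp_nat_mul]
  push_cast
  gcongr

theorem sum_exp_neg_le (k : ℕ) : ∑ r ∈ Finset.range k, Real.exp (-(r : ℝ)) ≤ 2 := by
  refine (Finset.sum_le_sum fun r _ => ?_).trans (sum_geometric_two_le k)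
  rw [show -(r : ℝ) = (r : ℝ) * (-1) by ring, Real.exp_nat_mul, Real.exp_neg, one_div]
  gcongr
  linarith [Real.add_one_le_exp (1 : ℝ)]

/-- The difference of the two sides is a square over 4a. The outer 3 is the loss of the net, the
inner 3σ the scale in `expSqSum`. -/
theorem mul_sqrt_le_young {a : ℝ} (ha : 0 < a) (σ K t : ℝ) (hK : 0 ≤ K) (ht : 0 ≤ t) :
    3 * (3 * σ * Real.sqrt K) * Real.sqrt t ≤ a * t + 81 * σ ^ 2 / (4 * a) * K := by
  have h1 := Real.sq_sqrt hK
  have h2 := Real.sq_sqrt ht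
  have h3 : a * t + 81 * σ ^ 2 / (4 * a) * K - 3 * (3 * σ * Real.sqrt K) * Real.sqrt t
      = (2 * a * Real.sqrt t - 9 * σ * Real.sqrt K) ^ 2 / (4 * a) := by
    nth_rewrite 1 [← h1]
    nth_rewrite 1 [← h2]
    field_simp
    ring
  have h4 : 0 ≤ (2 * a * Real.sqrt t - 9 * σ * Real.sqrt K) ^ 2 / (4 * a) := by positivity
  linarith

theorem log_numDistinctRows_nonneg {p m : ℕ} (B : Matrix (Fin p) (Fin m) ℝ) :
    0 ≤ Real.log (numDistinctRows B) := Real.log_natCast_nonneg _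

theorem numDistinctRows_le {p m : ℕ} (B : Matrix (Fin p) (Fin m) ℝ) : numDistinctRows B ≤ p := by
  rw [numDistinctRows, ← Set.image_univ]
  refine (Set.ncard_image_le).trans ?_
  simp [Set.ncard_univ]

theorem mul_rank_le_complexityPo {n p m : ℕ} (X : Matrix (Fin n) (Fin p) ℝ)
    (B : Matrix (Fin p) (Fin m) ℝ) : (m : ℝ) * B.rank ≤ complexityPo X B := by
  have h1 : (0 : ℝ) ≤ min (numDistinctRows B : ℝ) (X.rank : ℝ) := by positivity
  have h2 : (0 : ℝ) ≤ (p : ℝ) - numDistinctRows B :=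
    sub_nonneg.2 (by exact_mod_cast numDistinctRows_le B)
  have h3 := mul_nonneg h2 (log_numDistinctRows_nonneg B)
  have h4 : (0 : ℝ) ≤ B.rank := by positivity
  unfold complexityPo
  nlinarith

/-- Uniform control of the noise: with a random variable `R` of bounded mean,
`⟨E, X B - X B*⟩` is dominated by the prediction loss and the complexities, for all `B`. -/
theorem IsCenteredSubGaussian.exists_uniform_bound {p : ℕ} (hE : IsCenteredSubGaussian μ E σ)
    (hσ : 0 < σ) (hm : 1 ≤ m) (X : Matrix (Fin n) (Fin (p + 1)) ℝ)
    (Bstar : Matrix (Fin (p + 1)) (Fin m) ℝ) :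
    ∃ R : Ω → ℝ, (∀ ω, 0 ≤ R ω) ∧
      ∫⁻ ω, ENNReal.ofReal (R ω) ∂μ ≤ ENNReal.ofReal 14 ∧
      ∀ ω (B : Matrix (Fin (p + 1)) (Fin m) ℝ) (a : ℝ), 0 < a →
        frobInner (E ω) (X * B - X * Bstar) ≤ 2 * a * frobSq (X * B - X * Bstar)
          + 81 * σ ^ 2 / (4 * a)
            * (5 * complexityPo X B + 9 * complexityPo X Bstar + 4 + R ω) := by
  let G := X * Bstar
  let S₀ := LinearMap.range G.mulVecLin
  -- Adding the column space of XB* lets S contain the columns of XB - XB*.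
  let S : (Fin (p + 1) → Fin (p + 1)) → Submodule ℝ (Fin n → ℝ) := fun f => patternSpace X f ⊔ S₀
  obtain ⟨Q', hQ', hproj'⟩ := exists_orthonormal_matrix S₀
  choose Q hQ hproj using fun f => exists_orthonormal_matrix (S f)
  obtain ⟨N', hN'card, hN'frob, hN'⟩ := exists_columnSpace_net m hQ'
  choose N hNcard hNfrob hN using fun (x : (Σ _ : Finset (Fin (p + 1)), Fin (p + 1) → Fin (p + 1)) × ℕ) =>
    exists_lowRank_net x.2 m (hQ x.1.2)
  let s : (Fin (p + 1) → Fin (p + 1)) → ℕ := fun f => Module.finrank ℝ (S f)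
  -- Of the factor 5, 4 pays for the net, as 25 ≤ e⁴, and 1 leaves exp(-r) to sum over the ranks r,
  -- using m ≥ 1. The second term pays for the patterns.
  let L : (Σ _ : Finset (Fin (p + 1)), Fin (p + 1) → Fin (p + 1)) × ℕ → ℝ := fun x =>
    5 * (x.2 * (s x.1.2 + m)) + 3 * (((p : ℝ) - x.1.1.card) * Real.log (x.1.1.card + 1))
  let L' : ℝ := 4 * ((Module.finrank ℝ S₀ * m + 1 : ℕ) : ℝ)
  let idx := rowPatterns p ×ˢ Finset.range (m + 1)
  let R₁ : Ω → ℝ := fun ω => ∑ x ∈ idx, Real.exp (-L x) * expSqSum σ (N x) (E ω)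
  let R₂ : Ω → ℝ := fun ω => Real.exp (-L') * expSqSum σ N' (E ω)
  have hR₁nn : ∀ ω, 0 ≤ R₁ ω := fun ω => Finset.sum_nonneg fun x _ =>
    mul_nonneg (Real.exp_pos _).le (expSqSum_nonneg _ _ _)
  have hR₂nn : ∀ ω, 0 ≤ R₂ ω := fun ω => mul_nonneg (Real.exp_pos _).le (expSqSum_nonneg _ _ _)
  have hR₁m : AEMeasurable R₁ μ := Finset.aemeasurable_fun_sum _ fun x _ =>
    (hE.aemeasurable_expSqSum (N x)).const_mul _
  have hint₁ : ∫⁻ ω, ENNReal.ofReal (R₁ ω) ∂μ ≤ ENNReal.ofReal 12 := by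
    refine (hE.lintegral_sum_expSqSum_le hσ idx (fun x => Real.exp (-L x))
      (fun x => (Real.exp_pos _).le) hNfrob).trans (ENNReal.ofReal_le_ofReal ?_)
    calc ∑ x ∈ idx, Real.exp (-L x) * (2 * ((N x).card : ℝ))
        ≤ ∑ x ∈ idx, 2 * (Real.exp (-(3 * (((p : ℝ) - x.1.1.card) * Real.log (x.1.1.card + 1))))
            * Real.exp (-(x.2 : ℝ))) := by
          refine Finset.sum_le_sum fun x _ => ?_
          have h1 : ((N x).card : ℝ) ≤ Real.exp (4 * (x.2 * (s x.1.2 + m))) := by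
            refine (Nat.cast_le.2 (hNcard x)).trans ((pow_twentyFive_le_exp _).trans (le_of_eq ?_))
            simp only [s]
            push_cast
            ring_nf
          have h2 : (x.2 : ℝ) ≤ x.2 * (s x.1.2 + m) := by
            have : (1 : ℝ) ≤ m := by exact_mod_cast hm
            have h3 : (0 : ℝ) ≤ s x.1.2 := by positivity
            exact le_mul_of_one_le_right (by positivity) (by linarith)
          calc Real.exp (-L x) * (2 * ((N x).card : ℝ))
              ≤ Real.exp (-L x) * (2 * Real.exp (4 * (x.2 * (s x.1.2 + m)))) := by gcongr
            _ = 2 * Real.exp (-L x + 4 * (x.2 * (s x.1.2 + m))) := by rw [Real.exp_add]; ring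
            _ ≤ 2 * Real.exp (-(3 * (((p : ℝ) - x.1.1.card) * Real.log (x.1.1.card + 1)))
                  + -(x.2 : ℝ)) := by
                refine mul_le_mul_of_nonneg_left (Real.exp_le_exp.2 ?_) zero_le_two
                simp only [L]
                linarith
            _ = _ := by rw [Real.exp_add]
      _ = 2 * ((∑ x ∈ rowPatterns p,
            Real.exp (-(3 * (((p : ℝ) - x.1.card) * Real.log (x.1.card + 1)))))
            * ∑ r ∈ Finset.range (m + 1), Real.exp (-(r : ℝ))) := by
          rw [Finset.sum_mul_sum, ← Finset.sum_product', Finset.mul_sum]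
      _ ≤ 2 * (3 * 2) := by
          gcongr
          · exact sum_rowPatterns_le p
          · exact sum_exp_neg_le _
      _ = 12 := by norm_num
  have hint₂ : ∫⁻ ω, ENNReal.ofReal (R₂ ω) ∂μ ≤ ENNReal.ofReal 2 := by
    simp only [R₂, ENNReal.ofReal_mul (Real.exp_pos (-L')).le]
    rw [lintegral_const_mul' _ _ ENNReal.ofReal_ne_top]
    refine (mul_le_mul_right (hE.lintegral_expSqSum_le hσ hN'frob) _).trans ?_
    rw [← ENNReal.ofReal_mul (Real.exp_pos _).le]
    refine ENNReal.ofReal_le_ofReal ?_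
    have h1 : (N'.card : ℝ) ≤ Real.exp L' :=
      (Nat.cast_le.2 hN'card).trans (pow_twentyFive_le_exp _)
    calc Real.exp (-L') * (2 * (N'.card : ℝ)) ≤ Real.exp (-L') * (2 * Real.exp L') := by gcongr
      _ = 2 * Real.exp (-L' + L') := by rw [Real.exp_add]; ring
      _ = 2 := by simp
  refine ⟨fun ω => R₁ ω + R₂ ω, fun ω => add_nonneg (hR₁nn ω) (hR₂nn ω), ?_, ?_⟩
  · calc ∫⁻ ω, ENNReal.ofReal (R₁ ω + R₂ ω) ∂μ
        = ∫⁻ ω, ENNReal.ofReal (R₁ ω) ∂μ + ∫⁻ ω, ENNReal.ofReal (R₂ ω) ∂μ := by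
          rw [← lintegral_add_left' hR₁m.ennreal_ofReal]
          exact lintegral_congr fun ω => ENNReal.ofReal_add (hR₁nn ω) (hR₂nn ω)
      _ ≤ ENNReal.ofReal 12 + ENNReal.ofReal 2 := add_le_add hint₁ hint₂
      _ = ENNReal.ofReal 14 := by rw [← ENNReal.ofReal_add] <;> norm_num
  · intro ω B a ha
    obtain ⟨x, hx, hxcard, hxB⟩ := exists_rowPattern B
    obtain ⟨V, hV, hBV⟩ := exists_rowSpace_basis B
    have hrm : B.rank ≤ m := by simpa using B.rank_le_width
    have hmem : (x, B.rank) ∈ idx :=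
      Finset.mem_product.2 ⟨hx, Finset.mem_range.2 (Nat.lt_succ_of_le hrm)⟩
    set T := X * B - X * Bstar with hT
    have hcolT : ∀ j, (fun i => T i j) ∈ S x.2 := fun j => by
      have h1 : (fun i => (X * B) i j) ∈ S x.2 :=
        Submodule.mem_sup_left (mul_col_mem_patternSpace X hxB j)
      have h2 : (fun i => (X * Bstar) i j) ∈ S x.2 := by
        refine Submodule.mem_sup_right ?_
        have := mul_col_mem_range G 1 j
        rwa [Matrix.mul_one] at this
      exact Submodule.sub_mem _ h1 h2
    obtain ⟨z, z', hsplit, hz, hz'⟩ := exists_split (hQ x.2) hQ' hV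
      (U := X * B) (G := G)
      (by rw [Matrix.mul_assoc X, Matrix.mul_assoc X, hBV]) (hproj x.2 T hcolT)
      (fun M => hproj' (G * M) (mul_col_mem_range G M))
    have hTsq := frobSq_nonneg T
    have hp : x.1.card ≤ p := card_le_of_rowPatterns hx
    have hlog : 0 ≤ Real.log ((x.1.card : ℝ) + 1) := Real.log_nonneg (by simp)
    have hpsub : 0 ≤ (p : ℝ) - x.1.card := sub_nonneg.2 (by exact_mod_cast hp)
    have hLnn : 0 ≤ L (x, B.rank) := by
      simp only [L]
      positivity
    have hL'nn : 0 ≤ L' := by positivity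
    have hb₁ : frobInner (E ω) (Q x.2 * z * V)
        ≤ a * frobSq T + 81 * σ ^ 2 / (4 * a) * (L (x, B.rank) + R₁ ω) := by
      have hle : expSqSum σ (N (x, B.rank)) (E ω) ≤ Real.exp (L (x, B.rank)) * R₁ ω := by
        have h1 : Real.exp (-L (x, B.rank)) * expSqSum σ (N (x, B.rank)) (E ω) ≤ R₁ ω :=
          Finset.single_le_sum (f := fun x => Real.exp (-L x) * expSqSum σ (N x) (E ω))
            (fun x _ => mul_nonneg (Real.exp_pos _).le (expSqSum_nonneg _ _ _)) hmem
        rw [Real.exp_neg, inv_mul_le_iff₀ (Real.exp_pos _)] at h1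
        exact h1
      refine (hN (x, B.rank) (E ω) _ (by positivity)
        (fun W hW => frobInner_le_of_expSqSum_le hσ hle hW) z V hV).trans ?_
      refine le_trans ?_ (mul_sqrt_le_young ha σ _ _ (add_nonneg hLnn (hR₁nn ω)) hTsq)
      gcongr
    have hb₂ : frobInner (E ω) (Q' * z')
        ≤ a * frobSq T + 81 * σ ^ 2 / (4 * a) * (L' + R₂ ω) := by
      have hle : expSqSum σ N' (E ω) ≤ Real.exp L' * R₂ ω := by
        simp only [R₂]
        rw [← mul_assoc, ← Real.exp_add]
        simp
      refine (hN' (E ω) _ (fun W hW => frobInner_le_of_expSqSum_le hσ hle hW) z').trans ?_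
      refine le_trans ?_ (mul_sqrt_le_young ha σ _ _ (add_nonneg hL'nn (hR₂nn ω)) hTsq)
      gcongr
    have hs₀ : Module.finrank ℝ S₀ ≤ Bstar.rank := Matrix.rank_mul_le_right X Bstar
    have hs : s x.2 ≤ min (x.1.card + 1) X.rank + Bstar.rank := by
      refine (Submodule.finrank_add_le_finrank_add_finrank _ _).trans (add_le_add ?_ hs₀)
      have := finrank_patternSpace_le X (mem_insert_of_rowPatterns hx)
      rwa [card_insert_zero (Finset.mem_sigma.1 hx).1] at this
    have hPs := mul_rank_le_complexityPo X Bstar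
    have hL'le : L' ≤ 4 * complexityPo X Bstar + 4 := by
      have h1 : ((Module.finrank ℝ S₀ : ℝ)) * m ≤ m * Bstar.rank := by
        rw [mul_comm]
        gcongr
      simp only [L']
      push_cast
      linarith
    have hLle : L (x, B.rank) ≤ 5 * complexityPo X B + 5 * complexityPo X Bstar := by
      have hs' : (s x.2 : ℝ) ≤ min ((x.1.card : ℝ) + 1) X.rank + Bstar.rank := by exact_mod_cast hs
      have hrm' : (B.rank : ℝ) ≤ m := by exact_mod_cast hrm
      -- The cross term rank B · rank B* is at most m · rank B*, hence is charged to P_o(B*).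
      have h1 : (B.rank : ℝ) * (s x.2 + m)
          ≤ (min ((x.1.card : ℝ) + 1) X.rank + m) * B.rank + m * Bstar.rank := by
        calc (B.rank : ℝ) * (s x.2 + m)
            ≤ B.rank * (min ((x.1.card : ℝ) + 1) X.rank + Bstar.rank + m) := by gcongr
          _ = (min ((x.1.card : ℝ) + 1) X.rank + m) * B.rank + B.rank * Bstar.rank := by ring
          _ ≤ _ := by gcongr
      -- With p + 1 rows and |J| + 1 distinct ones, the factor of the logarithm is p - |J|.
      have h2 : complexityPo X B = (min ((x.1.card : ℝ) + 1) X.rank + m) * B.rank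
          + ((p : ℝ) - x.1.card) * Real.log (x.1.card + 1) := by
        rw [complexityPo, ← hxcard]
        push_cast
        ring_nf
      have h3 : 0 ≤ ((p : ℝ) - x.1.card) * Real.log (x.1.card + 1) := mul_nonneg hpsub hlog
      rw [h2]
      simp only [L]
      linarith
    have hK : 0 ≤ 81 * σ ^ 2 / (4 * a) := by positivity
    calc frobInner (E ω) T = frobInner (E ω) (Q x.2 * z * V) + frobInner (E ω) (Q' * z') := by
          rw [← frobInner_add, ← hsplit]
      _ ≤ 2 * a * frobSq T
          + 81 * σ ^ 2 / (4 * a) * (L (x, B.rank) + L' + (R₁ ω + R₂ ω)) := by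
          linarith
      _ ≤ _ := by
          refine add_le_add_right (mul_le_mul_of_nonneg_left ?_ hK) _
          linarith

end Stochastic

/-! ### The oracle inequality. -/

/-- Optimality bounds the loss difference inside the Bregman function from above, curvature bounds
the whole from below, and the gradient term is the noise. -/
theorem oracle_basic_inequality {n p m : ℕ} {X : Matrix (Fin n) (Fin p) ℝ}
    {l₀ : Matrix (Fin n) (Fin m) ℝ → Matrix (Fin n) (Fin m) ℝ → ℝ}
    {y : Matrix (Fin n) (Fin m) ℝ} {B Bstar : Matrix (Fin p) (Fin m) ℝ} {δ C A σ : ℝ}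
    (hcurv : δ * D2 (X * B) (X * Bstar) ≤ genBregman (fun η => l₀ η y) (X * B) (X * Bstar)
      + C * σ ^ 2 * complexityPo X B + C * σ ^ 2 * complexityPo X Bstar)
    (hopt : pic l₀ X y A σ B ≤ pic l₀ X y A σ Bstar) :
    δ / 2 * frobSq (X * B - X * Bstar) + (A - C) * (σ ^ 2 * complexityPo X B)
      ≤ frobInner (-matGradient (fun η => l₀ η y) (X * Bstar)) (X * B - X * Bstar)
        + (A + C) * (σ ^ 2 * complexityPo X Bstar) := by
  rw [frobInner_neg_left]
  simp only [D2, genBregman, pic] at hcurv hopt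
  linarith

theorem one_le_rank_of_ne_zero {p m : ℕ} {B : Matrix (Fin p) (Fin m) ℝ} (hB : B ≠ 0) :
    1 ≤ B.rank := by
  rw [Nat.one_le_iff_ne_zero]
  intro h
  have h1 : LinearMap.range B.mulVecLin = ⊥ := Submodule.finrank_eq_zero.1 h
  refine hB (Matrix.toLin'.injective ?_)
  rw [map_zero]
  exact LinearMap.range_eq_bot.1 h1

theorem theorem5 :
    ∀ δ C : ℝ, 0 < δ → 0 ≤ C →
    ∃ A₀ : ℝ, ∀ A : ℝ, A₀ ≤ A →
    ∃ c : ℝ, 0 < c ∧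
    ∀ (n p m : ℕ) (X : Matrix (Fin n) (Fin p) ℝ)
      (l₀ : Matrix (Fin n) (Fin m) ℝ → Matrix (Fin n) (Fin m) ℝ → ℝ)
      (Ω : Type*) [MeasurableSpace Ω] (μ : Measure Ω) [IsProbabilityMeasure μ]
      (Y : Ω → Matrix (Fin n) (Fin m) ℝ)
      (Bstar : Matrix (Fin p) (Fin m) ℝ) (σ : ℝ),
      0 ≤ σ →
      Bstar ≠ 0 →
      -- the loss is differentiable in the systematic component
      (∀ᵐ ω ∂μ, Differentiable ℝ fun η => l₀ η (Y ω)) →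
      IsCenteredSubGaussian μ (effectiveNoise l₀ X Y Bstar) σ →
      -- the restricted curvature condition
      (∀ᵐ ω ∂μ, ∀ B₁ B₂ : Matrix (Fin p) (Fin m) ℝ,
        δ * D2 (X * B₁) (X * B₂) ≤
          genBregman (fun η => l₀ η (Y ω)) (X * B₁) (X * B₂)
            + C * σ ^ 2 * complexityPo X B₁ + C * σ ^ 2 * complexityPo X B₂) →
      ∀ Bhat : Ω → Matrix (Fin p) (Fin m) ℝ,
        (∀ᵐ ω ∂μ, ∀ B : Matrix (Fin p) (Fin m) ℝ,
          pic l₀ X (Y ω) A σ (Bhat ω) ≤ pic l₀ X (Y ω) A σ B) →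
        ∫⁻ ω, ENNReal.ofReal
            (max (frobSq (X * Bhat ω - X * Bstar)) (σ ^ 2 * complexityPo X (Bhat ω))) ∂μ
          ≤ ENNReal.ofReal (c * (σ ^ 2 * complexityPo X Bstar)) := by
  intro δ C hδ hC
  -- With κ = 162/δ the noise bound costs 5κσ²P_o(B̂), and 5κ = 810/δ; the extra 1 keeps σ²P_o(B̂)
  -- on the left.
  refine ⟨C + 810 / δ + 1, fun A hA => ?_⟩
  have hκ : 0 < 162 / δ := by positivity
  have hA₀ : 0 < A := by
    have : 0 < 810 / δ := by positivity
    linarith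
  -- 27 = 9 + 4 + 14: the coefficient of P_o(B*) and the additive constant in the noise bound, and
  -- the bound on the mean of R.
  refine ⟨(4 / δ + 1) * (A + C + 27 * (162 / δ)), by positivity, ?_⟩
  intro n p m X l₀ Ω _ μ _ Y Bstar σ hσ hBstar _ hE hcurv Bhat hopt
  have hbasic : ∀ᵐ ω ∂μ, δ / 2 * frobSq (X * Bhat ω - X * Bstar)
      + (A - C) * (σ ^ 2 * complexityPo X (Bhat ω))
      ≤ frobInner (effectiveNoise l₀ X Y Bstar ω) (X * Bhat ω - X * Bstar)
        + (A + C) * (σ ^ 2 * complexityPo X Bstar) := by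
    filter_upwards [hcurv, hopt] with ω h1 h2
    exact oracle_basic_inequality (h1 _ _) (h2 _)
  rcases hσ.eq_or_lt with rfl | hσ
  -- If σ = 0, the noise vanishes almost surely and so do the penalties; the basic inequality then
  -- forces zero loss.
  · refine le_of_eq_of_le ?_ zero_le
    rw [← lintegral_zero (μ := μ)]
    refine lintegral_congr_ae ?_
    filter_upwards [hbasic, hE.ae_eq_zero] with ω h1 h2
    have h3 : frobInner (effectiveNoise l₀ X Y Bstar ω) (X * Bhat ω - X * Bstar) = 0 := by
      rw [h2]
      simp [frobInner]
    rw [h3] at h1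
    have h4 : frobSq (X * Bhat ω - X * Bstar) ≤ 0 := by
      by_contra! h
      have : 0 < δ / 2 * frobSq (X * Bhat ω - X * Bstar) := by positivity
      norm_num at h1
      linarith
    simpa using h4
  · have hp : 0 < p := by
      rcases Nat.eq_zero_or_pos p with rfl | h
      · exact absurd (Subsingleton.elim _ _) hBstar
      · exact h
    have hm : 0 < m := by
      rcases Nat.eq_zero_or_pos m with rfl | h
      · exact absurd (Subsingleton.elim _ _) hBstar
      · exact h
    obtain ⟨p, rfl⟩ := Nat.exists_eq_succ_of_ne_zero hp.ne'
    obtain ⟨R, hRnn, hRint, hR⟩ := hE.exists_uniform_bound hσ hm X Bstar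
    have hP : 1 ≤ complexityPo X Bstar := by
      refine le_trans ?_ (mul_rank_le_complexityPo X Bstar)
      have h1 : (1 : ℝ) ≤ m := by exact_mod_cast hm
      have h2 : (1 : ℝ) ≤ Bstar.rank := by exact_mod_cast one_le_rank_of_ne_zero hBstar
      nlinarith
    set κ := 162 / δ with hκdef
    set Ps := complexityPo X Bstar
    have hpoint : ∀ᵐ ω ∂μ,
        ENNReal.ofReal (max (frobSq (X * Bhat ω - X * Bstar)) (σ ^ 2 * complexityPo X (Bhat ω)))
        ≤ ENNReal.ofReal ((4 / δ + 1) * σ ^ 2 * ((A + C + 13 * κ) * Ps))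
          + ENNReal.ofReal ((4 / δ + 1) * σ ^ 2 * κ) * ENNReal.ofReal (R ω) := by
      filter_upwards [hbasic] with ω h1
      rw [← ENNReal.ofReal_mul (by positivity), ← ENNReal.ofReal_add (by positivity)
        (mul_nonneg (by positivity) (hRnn ω))]
      refine ENNReal.ofReal_le_ofReal ?_
      -- a = δ/8 spends δ/4 of the curvature δ/2 on the noise and gives 81σ²/(4a) = κσ².
      have h2 := hR ω (Bhat ω) (δ / 8) (by positivity)
      have h3 : 81 * σ ^ 2 / (4 * (δ / 8)) = κ * σ ^ 2 := by
        rw [hκdef]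
        field_simp
        norm_num
      rw [h3] at h2
      have hf := frobSq_nonneg (X * Bhat ω - X * Bstar)
      have hPh : 0 ≤ complexityPo X (Bhat ω) :=
        le_trans (by positivity) (mul_rank_le_complexityPo X (Bhat ω))
      set f := frobSq (X * Bhat ω - X * Bstar)
      set Ph := complexityPo X (Bhat ω)
      have hA' : 5 * κ + 1 ≤ A - C := by
        have : 5 * κ = 810 / δ := by rw [hκdef]; ring
        linarith
      have h4 : (5 * κ + 1) * (σ ^ 2 * Ph) ≤ (A - C) * (σ ^ 2 * Ph) := by gcongr
      have h5 : κ * σ ^ 2 * 4 ≤ κ * σ ^ 2 * (4 * Ps) := by gcongr; linarith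
      set D := σ ^ 2 * ((A + C + 13 * κ) * Ps + κ * R ω) with hD
      have h6 : δ / 4 * f + σ ^ 2 * Ph ≤ D := by
        rw [hD]
        linarith
      have h7 : 0 ≤ σ ^ 2 * Ph := by positivity
      have h8 : 0 ≤ δ / 4 * f := by positivity
      have h9 : f ≤ 4 / δ * D := by
        calc f = 4 / δ * (δ / 4 * f) := by field_simp
          _ ≤ 4 / δ * D := by gcongr; linarith
      have h10 : 0 ≤ 4 / δ * D := hf.trans h9
      calc max f (σ ^ 2 * Ph) ≤ (4 / δ + 1) * D := by
            refine max_le ?_ ?_ <;> linarith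
        _ = _ := by rw [hD]; ring
    calc ∫⁻ ω, ENNReal.ofReal
          (max (frobSq (X * Bhat ω - X * Bstar)) (σ ^ 2 * complexityPo X (Bhat ω))) ∂μ
        ≤ ∫⁻ ω, (ENNReal.ofReal ((4 / δ + 1) * σ ^ 2 * ((A + C + 13 * κ) * Ps))
          + ENNReal.ofReal ((4 / δ + 1) * σ ^ 2 * κ) * ENNReal.ofReal (R ω)) ∂μ :=
          lintegral_mono_ae hpoint
      _ = ENNReal.ofReal ((4 / δ + 1) * σ ^ 2 * ((A + C + 13 * κ) * Ps))
          + ENNReal.ofReal ((4 / δ + 1) * σ ^ 2 * κ) * ∫⁻ ω, ENNReal.ofReal (R ω) ∂μ := by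
          rw [lintegral_add_left measurable_const, lintegral_const, measure_univ, mul_one,
            lintegral_const_mul' _ _ ENNReal.ofReal_ne_top]
      _ ≤ ENNReal.ofReal ((4 / δ + 1) * σ ^ 2 * ((A + C + 13 * κ) * Ps))
          + ENNReal.ofReal ((4 / δ + 1) * σ ^ 2 * κ) * ENNReal.ofReal 14 := by gcongr
      _ = ENNReal.ofReal ((4 / δ + 1) * σ ^ 2 * ((A + C + 13 * κ) * Ps)
          + (4 / δ + 1) * σ ^ 2 * κ * 14) := by
          rw [← ENNReal.ofReal_mul (by positivity), ← ENNReal.ofReal_add (by positivity)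
            (by positivity)]
      _ ≤ _ := by
          refine ENNReal.ofReal_le_ofReal ?_
          have : (4 / δ + 1) * σ ^ 2 * κ * 14 * 1 ≤ (4 / δ + 1) * σ ^ 2 * κ * 14 * Ps := by gcongr
          linarith
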